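/- Let $\Omega\subseteq\mathbb{C}$ be open, $X$ a complex Banach space with dual $X'$, and $H$ a complex Hilbert space with dual $H'$. **Spaces of operators.** For a bounded linear $T:H\to X$ let $\|T\|_\gamma=\sup\big(\mathbb{E}\|\sum_{j}\gamma_jTe_j\|^2\big)^{1/2}$, the supremum being taken over all finite orthonormal systems $(e_j)$ in $H$, where the $\gamma_j$ are independent complex standard Gaussians (that is, $\gamma_j=\gamma_j^r+i\gamma_j^i$ with independent real standard Gaussians $\gamma_j^r,\gamma_j^i$). Let $\gamma(H;X)$ be the $\|\cdot\|_\gamma$-closure of the finite rank operators in $\{T:\|T\|_\gamma<\infty\}$. Let $\gamma'(H';X')$ be the space of bounded linear $V:H'\to X'$ with $\|V\|_{\gamma'}=\sup\{|\mathrm{tr}(V'U)| : U:H\to X \text{ of finite rank},\ \|U\|_\gamma\le1\}<\infty$. For $U\in\gamma(H;X)$ and $V\in\gamma'(H';X')$ put $\langle U,V\rangle=\mathrm{tr}(V'U)=\sum_\alpha\langle Ue_\alpha,V\overline{e_\alpha}\rangle$, where $(e_\alpha)$ is any orthonormal basis of $H$ and $\overline{e_\alpha}=(\,\cdot\,|\,e_\alpha)\in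 H'$ (the series converges unconditionally, with a sum independent of the basis). **Functional calculus.** Let $\mathcal{E}$ be a subalgebra of $H^\infty(\Omega)$, the algebra of bounded holomorphic functions on $\Omega$, and $\Phi:\mathcal{E}\to\mathcal{L}(X)$ an algebra homomorphism. Assume that there is $e\in\mathcal{E}$ such that 1. $ef\in\mathcal{E}$ for all $f\in H^\infty(\Omega)$; 2. if $(f_n)$ is a sequence in $H^\infty(\Omega)$ with $\sup_n\|f_n\|_\infty<\infty$ and $f_n\to f\in H^\infty(\Omega)$ pointwise, then $\Phi(ef_n)\to\Phi(ef)$ in the weak operator topology; 3. $\Phi(e)$ is injective. For $f\in H^\infty(\Omega)$ let $\Phi(f)=\Phi(e)^{-1}\Phi(ef)$ with its natural domain (this does not depend on the choice of $e\in\mathcal E$ with $ef\in\mathcal{E}$ and $\Phi(e)$ injective). **Square functions.** Let $g:\Omega\to H'$ with $\langle h,g(\cdot)\rangle\in H^\infty(\Omega)$ for all $h\in H$ (written $g\in H^\infty(\Omega;H')$). The operator $\Phi_\gamma(g):\mathrm{dom}(\Phi_\gamma(g))\subseteq X\to\gamma(H;X)$ is defined by $[\Phi_\gamma(g)x]h=\Phi(\langle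 h,g\rangle)x$, its domain being the set of all $x\in\bigcap_{h\in H}\mathrm{dom}(\Phi(\langle h,g\rangle))$ for which $h\mapsto\Phi(\langle h,g\rangle)x$ belongs to $\gamma(H;X)$. Let $f:\Omega\to H$ with $\langle f(\cdot),h'\rangle\in H^\infty(\Omega)$ for all $h'\in H'$ (written $f\in H^\infty(\Omega;H)$), and assume that $\Phi(\langle f,h'\rangle)$ is densely defined for every $h'\in H'$. The operator $\Phi_{\gamma'}(f):\mathrm{dom}(\Phi_{\gamma'}(f))\subseteq X'\to\gamma'(H';X')$ is defined by $[\Phi_{\gamma'}(f)x']h'=\Phi(\langle f,h'\rangle)'x'$, its domain being the set of all $x'\in\bigcap_{h'\in H'}\mathrm{dom}(\Phi(\langle f,h'\rangle)')$ for which $h'\mapsto\Phi(\langle f,h'\rangle)'x'$ belongs to $\gamma'(H';X')$. Call such an operator *bounded* if it is defined on all of $X$ (respectively $X'$) and satisfies a norm estimate $\|\Phi_\gamma(g)x\|_\gamma\le K\|x\|$ (respectively $\|\Phi_{\gamma'}(f)x'\|_{\gamma'}\le K\|x'\|$). Let $\langle f,g\rangle(z)=\langle f(z),g(z)\rangle$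 for $z\in\Omega$. **Theorem.** Let $f\in H^\infty(\Omega;H)$ and $g\in H^\infty(\Omega;H')$ be as above, and suppose that $\Phi_{\gamma'}(f)$ is bounded. Then $$\Phi_{\gamma'}(f)'\,\Phi_\gamma(g)\subseteq\Phi(\langle f,g\rangle),$$ where, for $U\in\gamma(H;X)$ and $y\in X$, $\Phi_{\gamma'}(f)'U=y$ means that $\langle y,x'\rangle=\langle U,\Phi_{\gamma'}(f)x'\rangle$ for all $x'\in X'$. Moreover $\mathrm{dom}(\Phi_\gamma(g))\subseteq\mathrm{dom}(\Phi(\langle f,g\rangle))$ and $$\langle\Phi(\langle f,g\rangle)x,x'\rangle=\langle\Phi_\gamma(g)x,\Phi_{\gamma'}(f)x'\rangle\qquad(x\in\mathrm{dom}(\Phi_\gamma(g)),\ x'\in X').$$ In particular, if $K\ge0$ satisfies $\|\Phi_{\gamma'}(f)x'\|_{\gamma'}\le K\|x'\|$ for all $x'\in X'$, then $\|\Phi(\langle f,g\rangle)x\|\le K\,\|\Phi_\gamma(g)x\|_\gamma$ for all $x\in\mathrm{dom}(\Phi_\gamma(g))$. **Corollary.** If in addition $\Phi_\gamma(g)$ is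 bounded, then $\Phi(\langle f,g\rangle)$ is a bounded operator defined on all of $X$, and the duality formula holds for all $x\in X$ and $x'\in X'$. If moreover $\langle f,g\rangle=1$ on $\Omega$, then there are constants $c,K>0$ with $c\|x\|\le\|\Phi_\gamma(g)x\|_\gamma\le K\|x\|$ for all $x\in X$. -/

import Mathlib

set_option maxSynthPendingDepth 3

open MeasureTheory ProbabilityTheory Filter Topology
open scoped ENNReal NNReal

noncomputable section

namespace SquareFn

/-! ## Gamma-radonifying operators -/

section Gamma

variable {H X : Type*} [NormedAddCommGroup H] [InnerProductSpace ℂ H]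
  [NormedAddCommGroup X] [NormedSpace ℂ X]

/-- The law of `n` independent pairs of independent real standard Gaussians. -/
def gaussPairs (n : ℕ) : Measure (Fin n → ℝ × ℝ) :=
  Measure.pi fun _ => (gaussianReal 0 1).prod (gaussianReal 0 1)

/-- The `j`-th of `n` independent complex standard Gaussians `γ_r + i γ_i` (with `γ_r`, `γ_i`
independent real standard Gaussians), as a random variable on the space of `gaussPairs n`. -/
def cGauss {n : ℕ} (j : Fin n) (w : Fin n → ℝ × ℝ) : ℂ :=
  ((w j).1 : ℂ) + ((w j).2 : ℂ) * Complex.I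

/-- `(E ‖∑ j, γ_j x_j‖²)^(1/2)` for independent complex standard Gaussians `γ_j`. -/
def gaussL2 {n : ℕ} (x : Fin n → X) : ℝ≥0∞ :=
  (∫⁻ w, ‖∑ j, cGauss j w • x j‖ₑ ^ (2 : ℝ) ∂gaussPairs n) ^ (1 / 2 : ℝ)

/-- The `γ`-norm: the supremum of `(E ‖∑ j, γ_j T e_j‖²)^(1/2)` over all finite orthonormal
systems `(e_j)` in `H`; it is `∞` iff `T` is not `γ`-summing. -/
def gammaNorm (T : H →L[ℂ] X) : ℝ≥0∞ :=
  ⨆ (n : ℕ) (e : Fin n → H) (_ : Orthonormal ℂ e), gaussL2 fun j => T (e j)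

theorem gaussL2_add_le {n : ℕ} (x y : Fin n → X) :
    gaussL2 (x + y) ≤ gaussL2 x + gaussL2 y := by
  have hm : ∀ z : Fin n → X,
      AEMeasurable (fun w => ‖∑ j, cGauss j w • z j‖ₑ) (gaussPairs n) := fun z => by
    refine (Continuous.measurable ?_).aemeasurable
    unfold cGauss
    fun_prop
  refine le_trans ?_ (ENNReal.lintegral_Lp_add_le (hm x) (hm y) (by norm_num : (1 : ℝ) ≤ 2))
  refine ENNReal.rpow_le_rpow (lintegral_mono fun w => ?_) (by norm_num)
  refine ENNReal.rpow_le_rpow ?_ (by norm_num)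
  simp only [Pi.add_apply, smul_add, Finset.sum_add_distrib]
  exact enorm_add_le _ _

theorem gaussL2_smul_le {n : ℕ} (c : ℂ) (x : Fin n → X) :
    gaussL2 (c • x) ≤ ‖c‖ₑ * gaussL2 x := by
  unfold gaussL2
  have h : ∀ w : Fin n → ℝ × ℝ, ‖∑ j, cGauss j w • (c • x) j‖ₑ ^ (2 : ℝ)
      = ‖c‖ₑ ^ (2 : ℝ) * ‖∑ j, cGauss j w • x j‖ₑ ^ (2 : ℝ) := fun w => by
    rw [← ENNReal.mul_rpow_of_nonneg _ _ (by norm_num), ← enorm_smul, Finset.smul_sum]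
    simp only [Pi.smul_apply, smul_comm c]
  simp only [h]
  rw [lintegral_const_mul' _ _ (by simp), ENNReal.mul_rpow_of_nonneg _ _ (by norm_num),
    ← ENNReal.rpow_mul]
  norm_num

theorem gammaNorm_add_le (S T : H →L[ℂ] X) :
    gammaNorm (S + T) ≤ gammaNorm S + gammaNorm T := by
  refine iSup_le fun n => iSup_le fun e => iSup_le fun he => ?_
  refine (gaussL2_add_le (fun j => S (e j)) (fun j => T (e j))).trans ?_
  refine add_le_add ?_ ?_
  · exact le_iSup_of_le n (le_iSup_of_le e (le_iSup_of_le he le_rfl))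
  · exact le_iSup_of_le n (le_iSup_of_le e (le_iSup_of_le he le_rfl))

theorem gammaNorm_smul_le (c : ℂ) (T : H →L[ℂ] X) :
    gammaNorm (c • T) ≤ ‖c‖ₑ * gammaNorm T := by
  refine iSup_le fun n => iSup_le fun e => iSup_le fun he => ?_
  refine (gaussL2_smul_le c (fun j => T (e j))).trans ?_
  gcongr
  exact le_iSup_of_le n (le_iSup_of_le e (le_iSup_of_le he le_rfl))

theorem gammaNorm_zero : gammaNorm (0 : H →L[ℂ] X) = 0 := by
  simpa using gammaNorm_smul_le (0 : ℂ) (0 : H →L[ℂ] X)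

/-- `T` has finite rank. -/
def IsFiniteRank (T : H →L[ℂ] X) : Prop :=
  FiniteDimensional ℂ (LinearMap.range (T : H →ₗ[ℂ] X))

variable (H X) in
/-- The space `γ(H;X)` of `γ`-radonifying operators: the closure, with respect to the `γ`-norm,
of the finite rank operators in the space of `γ`-summing operators. -/
def gammaRad : Submodule ℂ (H →L[ℂ] X) where
  carrier := {T | gammaNorm T < ∞ ∧
    ∀ ε : ℝ≥0∞, 0 < ε → ∃ S : H →L[ℂ] X, IsFiniteRank S ∧ gammaNorm (T - S) < ε}
  zero_mem' := by
    refine ⟨by simp [gammaNorm_zero], fun ε hε => ⟨0, ?_, by simpa [gammaNorm_zero] using hε⟩⟩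
    have h0 : LinearMap.range ((0 : H →L[ℂ] X) : H →ₗ[ℂ] X) = ⊥ := LinearMap.range_zero
    rw [IsFiniteRank, h0]
    infer_instance
  add_mem' := by
    rintro S T ⟨hS, hS'⟩ ⟨hT, hT'⟩
    refine ⟨(gammaNorm_add_le S T).trans_lt (ENNReal.add_lt_top.2 ⟨hS, hT⟩), fun ε hε => ?_⟩
    obtain ⟨S₀, hr, hs⟩ := hS' (ε / 2) (ENNReal.half_pos hε.ne')
    obtain ⟨T₀, hr', ht⟩ := hT' (ε / 2) (ENNReal.half_pos hε.ne')
    refine ⟨S₀ + T₀, ?_, ?_⟩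
    · unfold IsFiniteRank at *
      exact Submodule.finiteDimensional_of_le
        (LinearMap.range_add_le (S₀ : H →ₗ[ℂ] X) (T₀ : H →ₗ[ℂ] X))
    · rw [add_sub_add_comm]
      refine (gammaNorm_add_le _ _).trans_lt ?_
      rw [← ENNReal.add_halves ε]
      exact ENNReal.add_lt_add hs ht
  smul_mem' := by
    rintro c T ⟨hT, hT'⟩
    refine ⟨(gammaNorm_smul_le c T).trans_lt (ENNReal.mul_lt_top (by simp) hT), fun ε hε => ?_⟩
    obtain ⟨S, hr, hs⟩ := hT' (ε / (‖c‖ₑ + 1)) (ENNReal.div_pos hε.ne' (by simp))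
    refine ⟨c • S, ?_, ?_⟩
    · unfold IsFiniteRank at *
      refine Submodule.finiteDimensional_of_le
        (S₂ := LinearMap.range (S : H →ₗ[ℂ] X)) ?_
      rintro _ ⟨h, rfl⟩
      exact Submodule.smul_mem _ c ⟨h, rfl⟩
    · rw [← smul_sub]
      refine (gammaNorm_smul_le _ _).trans_lt ?_
      have h1 : ‖c‖ₑ * gammaNorm (T - S) ≤ (‖c‖ₑ + 1) * gammaNorm (T - S) := by
        gcongr
        exact le_self_add
      refine h1.trans_lt ?_
      rw [mul_comm]
      exact (ENNReal.lt_div_iff_mul_lt (by simp) (by simp)).1 hs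

/-! ### The dual space under trace duality -/

/-- The `γ'`-norm of `V : H' → X'`: the supremum of `|tr (V'U)|` over all finite rank operators
`U : H → X` with `‖U‖_γ ≤ 1`. The finite rank operators are the `U = ∑ j, g_j ⊗ x_j` with
`g_j ∈ H'`, `x_j ∈ X`, and then `tr (V'U) = ∑ j, ⟨x_j, V g_j⟩`. -/
def gammaDualNorm (V : StrongDual ℂ H →L[ℂ] StrongDual ℂ X) : ℝ≥0∞ :=
  ⨆ (n : ℕ) (g : Fin n → StrongDual ℂ H) (x : Fin n → X)
    (_ : gammaNorm (∑ j, (g j).smulRight (x j)) ≤ 1), ‖∑ j, V (g j) (x j)‖ₑ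

theorem gammaDualNorm_add_le (V W : StrongDual ℂ H →L[ℂ] StrongDual ℂ X) :
    gammaDualNorm (V + W) ≤ gammaDualNorm V + gammaDualNorm W := by
  refine iSup_le fun n => iSup_le fun g => iSup_le fun x => iSup_le fun h => ?_
  simp only [add_apply, Finset.sum_add_distrib]
  refine (enorm_add_le _ _).trans (add_le_add ?_ ?_)
  · exact le_iSup_of_le n (le_iSup_of_le g (le_iSup_of_le x (le_iSup_of_le h le_rfl)))
  · exact le_iSup_of_le n (le_iSup_of_le g (le_iSup_of_le x (le_iSup_of_le h le_rfl)))

theorem gammaDualNorm_smul_le (c : ℂ) (V : StrongDual ℂ H →L[ℂ] StrongDual ℂ X) :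
    gammaDualNorm (c • V) ≤ ‖c‖ₑ * gammaDualNorm V := by
  refine iSup_le fun n => iSup_le fun g => iSup_le fun x => iSup_le fun h => ?_
  simp only [smul_apply, ← Finset.smul_sum, enorm_smul]
  gcongr
  exact le_iSup_of_le n (le_iSup_of_le g (le_iSup_of_le x (le_iSup_of_le h le_rfl)))

variable (H X) in
/-- The space `γ'(H';X')` of all `V : H' → X'` with finite `γ'`-norm. -/
def gammaDual : Submodule ℂ (StrongDual ℂ H →L[ℂ] StrongDual ℂ X) where
  carrier := {V | gammaDualNorm V < ∞}
  zero_mem' := by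
    simp [gammaDualNorm]
  add_mem' := fun {V W} hV hW =>
    (gammaDualNorm_add_le V W).trans_lt (ENNReal.add_lt_top.2 ⟨hV, hW⟩)
  smul_mem' := fun c V hV =>
    (gammaDualNorm_smul_le c V).trans_lt (ENNReal.mul_lt_top (by simp) hV)

end Gamma

universe u v

section Trace

variable {H : Type u} [NormedAddCommGroup H] [InnerProductSpace ℂ H]
  {X : Type v} [NormedAddCommGroup X] [NormedSpace ℂ X]

/-- Trace duality between `γ(H;X)` and `γ'(H';X')`: the statement `⟨U, V⟩ = tr (V'U) = t`.
The trace of `V'U` is its sum of diagonal entries `⟨U b_i, V (conj b_i)⟩`, where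
`conj b_i = (· | b_i) ∈ H'`; the series has to converge unconditionally to `t` for every
orthonormal basis `b` of `H`. -/
def HasTraceDuality (U : gammaRad H X) (V : gammaDual H X) (t : ℂ) : Prop :=
  ∀ (ι : Type u) (b : HilbertBasis ι ℂ H),
    HasSum (fun i => V.1 (innerSL ℂ (b i)) (U.1 (b i))) t

/-- The graph of the part in `γ(H;X) × X` of the adjoint `B' : γ'(H';X')' → X''` of an operator
`B : X' → γ'(H';X')`, where `γ(H;X)` embeds into `γ'(H';X')'` by trace duality and `X` embeds
into `X''` canonically: `y = B'U` iff `⟨y, x'⟩ = ⟨U, B x'⟩` for all `x'` in the domain. -/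
def traceAdjointGraph (B : StrongDual ℂ X →ₗ.[ℂ] gammaDual H X) : Set (gammaRad H X × X) :=
  {p | ∀ x' : B.domain, HasTraceDuality p.1 (B x') (x'.1 p.2)}

end Trace

/-! ## Functional calculus -/

/-- An abstract functional calculus `(E, F, Φ)` on `X`: `F` is a unital algebra of scalar functions
on `S`, `E` a (not necessarily unital) subalgebra of `F`, and `Φ : E → L(X)` an algebra
homomorphism. -/
structure FunctionalCalculus {S : Type*} (F : Subalgebra ℂ (S → ℂ)) (X : Type*)
    [NormedAddCommGroup X] [NormedSpace ℂ X] where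
  /-- the algebra of elementary functions -/
  E : NonUnitalSubalgebra ℂ (S → ℂ)
  E_le : ∀ f ∈ E, f ∈ F
  /-- the elementary calculus -/
  Φ : E →ₙₐ[ℂ] (X →L[ℂ] X)

/-- The graph of the adjoint `A'` of an operator `A` on `X`. -/
def adjointGraph {X : Type*} [NormedAddCommGroup X] [NormedSpace ℂ X] (A : X →ₗ.[ℂ] X) :
    Submodule ℂ (StrongDual ℂ X × StrongDual ℂ X) where
  carrier := {p | ∀ x : A.domain, p.1 (A x) = p.2 x}
  zero_mem' := fun x => by simp
  add_mem' := fun {p q} hp hq x => by simp [hp x, hq x]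
  smul_mem' := fun c p hp x => by simp [hp x]

/-- The adjoint `A'` of a densely defined operator `A` on `X`. -/
def adjointOp {X : Type*} [NormedAddCommGroup X] [NormedSpace ℂ X] (A : X →ₗ.[ℂ] X) :
    StrongDual ℂ X →ₗ.[ℂ] StrongDual ℂ X :=
  (adjointGraph A).toLinearPMap

section Functions

variable {S H : Type*} [NormedAddCommGroup H] [InnerProductSpace ℂ H]

/-- `F(S;H')`: the functions `g : S → H'` with `z ↦ ⟨h, g z⟩` in `F` for all `h ∈ H`. -/
def MemDualValued (F : Subalgebra ℂ (S → ℂ)) (g : S → StrongDual ℂ H) : Prop :=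
  ∀ h : H, (fun z => g z h) ∈ F

/-- `F(S;H)`: the functions `f : S → H` with `z ↦ ⟨f z, h'⟩` in `F` for all `h' ∈ H'`. -/
def MemValued (F : Subalgebra ℂ (S → ℂ)) (f : S → H) : Prop :=
  ∀ h' : StrongDual ℂ H, (fun z => h' (f z)) ∈ F

/-- The scalar function `⟨f, g⟩ : z ↦ ⟨f z, g z⟩_{H,H'}`. -/
def pairing (f : S → H) (g : S → StrongDual ℂ H) : S → ℂ := fun z => g z (f z)

end Functions

/-- The algebra `H^∞(Ω)` of bounded holomorphic functions on an (open) set `Ω ⊆ ℂ`. -/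
def HInfty (Ω : Set ℂ) : Subalgebra ℂ (Ω → ℂ) where
  carrier := {f | (∃ F : ℂ → ℂ, DifferentiableOn ℂ F Ω ∧ ∀ z : Ω, F z = f z) ∧
    ∃ K : ℝ, ∀ z, ‖f z‖ ≤ K}
  add_mem' := by
    rintro f g ⟨⟨F, hF, hf⟩, K, hK⟩ ⟨⟨G, hG, hg⟩, L, hL⟩
    exact ⟨⟨F + G, hF.add hG, fun z => by simp [hf, hg]⟩, K + L, fun z =>
      (norm_add_le _ _).trans (add_le_add (hK z) (hL z))⟩
  mul_mem' := by
    rintro f g ⟨⟨F, hF, hf⟩, K, hK⟩ ⟨⟨G, hG, hg⟩, L, hL⟩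
    refine ⟨⟨F * G, hF.mul hG, fun z => by simp [hf, hg]⟩, K * L, fun z => ?_⟩
    rw [Pi.mul_apply, norm_mul]
    exact mul_le_mul (hK z) (hL z) (norm_nonneg _) ((norm_nonneg _).trans (hK z))
  algebraMap_mem' := fun c =>
    ⟨⟨fun _ => c, differentiableOn_const c, fun z => rfl⟩, ‖c‖, fun z => le_rfl⟩

namespace FunctionalCalculus

variable {S : Type*} {F : Subalgebra ℂ (S → ℂ)} {X : Type*} [NormedAddCommGroup X]
  [NormedSpace ℂ X] (C : FunctionalCalculus F X)

/-- `e ∈ E` is a regulariser of `f`: `e f ∈ E` and `Φ(e)` is injective. -/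
def IsRegulariser (e : C.E) (f : S → ℂ) : Prop :=
  (e : S → ℂ) * f ∈ C.E ∧ Function.Injective (C.Φ e)

/-- The graph of `Φ(f) = Φ(e)⁻¹ Φ(e f)`: the pairs `(x, y)` with `Φ(e) y = Φ(e f) x`, for any
regulariser `e` of `f` (the choice does not matter, see `mem_graph_Phi_iff`). -/
def graphPhi (f : S → ℂ) : Submodule ℂ (X × X) where
  carrier := {p | ∀ (e : C.E) (he : C.IsRegulariser e f),
    C.Φ e p.2 = C.Φ ⟨(e : S → ℂ) * f, he.1⟩ p.1}
  zero_mem' := fun e he => by simp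
  add_mem' := fun {p q} hp hq e he => by simp [hp e he, hq e he]
  smul_mem' := fun c p hp e he => by simp [hp e he]

/-- The operator `Φ(f)`, for a regularisable function `f`, with its natural domain. -/
def Phi (f : S → ℂ) : X →ₗ.[ℂ] X := (C.graphPhi f).toLinearPMap

theorem mem_graph_Phi_iff {f : S → ℂ} {e : C.E} (he : C.IsRegulariser e f) (x y : X) :
    (x, y) ∈ (C.Phi f).graph ↔ C.Φ e y = C.Φ ⟨(e : S → ℂ) * f, he.1⟩ x := by
  have hfun : ∀ p ∈ C.graphPhi f, p.1 = 0 → p.2 = 0 := fun p hp h0 => by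
    have := hp e he
    rw [h0, map_zero] at this
    exact he.2 (this.trans (map_zero _).symm)
  rw [Phi, Submodule.toLinearPMap_graph_eq _ hfun]
  refine ⟨fun h => h e he, fun h d hd => ?_⟩
  refine he.2 ?_
  have h1 : C.Φ e (C.Φ d y) = C.Φ d (C.Φ e y) := by
    rw [← mul_apply_eq_comp, ← mul_apply_eq_comp, ← map_mul, ← map_mul]
    congr 2
    exact Subtype.ext (mul_comm _ _)
  have h2 : C.Φ e (C.Φ ⟨(d : S → ℂ) * f, hd.1⟩ x) = C.Φ d (C.Φ ⟨(e : S → ℂ) * f, he.1⟩ x) := by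
    rw [← mul_apply_eq_comp, ← mul_apply_eq_comp, ← map_mul, ← map_mul]
    congr 2
    exact Subtype.ext (mul_left_comm _ _ _)
  change C.Φ e (C.Φ d y) = C.Φ e (C.Φ ⟨(d : S → ℂ) * f, hd.1⟩ x)
  rw [h1, h2, h]

variable {H : Type*} [NormedAddCommGroup H] [InnerProductSpace ℂ H]

/-- The graph of `Φ(g)`, for `g` with values in `H'`: the pairs `(x, T)` with `T : H → X` such that
`x` is in the domain of `Φ(⟨h, g⟩)` and `T h = Φ(⟨h, g⟩) x`, for all `h ∈ H`. -/
def graphVec (g : S → StrongDual ℂ H) : Submodule ℂ (X × (H →L[ℂ] X)) where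
  carrier := {p | ∀ h : H, (p.1, p.2 h) ∈ (C.Phi fun z => g z h).graph}
  zero_mem' := fun _ => Submodule.zero_mem _
  add_mem' := fun hp hq h => Submodule.add_mem _ (hp h) (hq h)
  smul_mem' := fun c _ hp h => Submodule.smul_mem _ c (hp h)

/-- The square function `Φ_γ(g) : dom(Φ_γ(g)) → γ(H;X)`: the part of `Φ(g)` in `γ(H;X)`. -/
def PhiGamma (g : S → StrongDual ℂ H) : X →ₗ.[ℂ] gammaRad H X :=
  ((C.graphVec g).comap
    (LinearMap.prodMap LinearMap.id (gammaRad H X).subtype)).toLinearPMap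

/-- The graph of `Φ^d(f)`, for `f` with values in `H`: the pairs `(x', V)` with `V : H' → X'` such
that `x'` is in the domain of `Φ(⟨f, h'⟩)'` and `V h' = Φ(⟨f, h'⟩)' x'`, for all `h' ∈ H'`. -/
def graphVecDual (f : S → H) :
    Submodule ℂ (StrongDual ℂ X × (StrongDual ℂ H →L[ℂ] StrongDual ℂ X)) where
  carrier := {p | ∀ h' : StrongDual ℂ H,
    (p.1, p.2 h') ∈ (adjointOp (C.Phi fun z => h' (f z))).graph}
  zero_mem' := fun _ => Submodule.zero_mem _
  add_mem' := fun hp hq h => Submodule.add_mem _ (hp h) (hq h)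
  smul_mem' := fun c _ hp h => Submodule.smul_mem _ c (hp h)

/-- The dual square function `Φ_γ'(f) : dom(Φ_γ'(f)) → γ'(H';X')`: the part of `Φ^d(f)` in
`γ'(H';X')`. -/
def PhiGammaDual (f : S → H) : StrongDual ℂ X →ₗ.[ℂ] gammaDual H X :=
  ((C.graphVecDual f).comap
    (LinearMap.prodMap LinearMap.id (gammaDual H X).subtype)).toLinearPMap

/-- The standing assumption under which dual square functions are considered: `Φ(⟨f, h'⟩)` is
densely defined for all `h' ∈ H'`, so that its adjoint is single-valued. -/
def DualWellDefined (f : S → H) : Prop :=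
  ∀ h' : StrongDual ℂ H, Dense ((C.Phi fun z => h' (f z)).domain : Set X)

/-- `Φ_γ(g)` is bounded with bound `K`: it is defined on all of `X` and
`‖Φ_γ(g) x‖_γ ≤ K ‖x‖`. -/
def PhiGammaBound (g : S → StrongDual ℂ H) (K : ℝ≥0) : Prop :=
  (C.PhiGamma g).domain = ⊤ ∧
    ∀ x : (C.PhiGamma g).domain, gammaNorm (C.PhiGamma g x).1 ≤ K * ‖(x : X)‖ₑ

/-- `Φ_γ'(f)` is bounded with bound `K`: it is defined on all of `X'` and
`‖Φ_γ'(f) x'‖_γ' ≤ K ‖x'‖`. -/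
def PhiGammaDualBound (f : S → H) (K : ℝ≥0) : Prop :=
  (C.PhiGammaDual f).domain = ⊤ ∧
    ∀ x' : (C.PhiGammaDual f).domain,
      gammaDualNorm (C.PhiGammaDual f x').1 ≤ K * ‖(x' : StrongDual ℂ X)‖ₑ

end FunctionalCalculus

/-- The requirements on `e` for a calculus `(E, H^∞(Ω), Φ)`: `e` multiplies `H^∞(Ω)` into `E`,
`f ↦ Φ(e f)` turns bounded pointwise convergence of sequences into weak operator convergence, and
`Φ(e)` is injective. -/
structure IsUniversalRegulariser {Ω : Set ℂ} {X : Type*} [NormedAddCommGroup X] [NormedSpace ℂ X]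
    (C : FunctionalCalculus (HInfty Ω) X) (e : C.E) : Prop where
  mul_mem : ∀ f ∈ HInfty Ω, (e : Ω → ℂ) * f ∈ C.E
  weak_conv : ∀ (f : ℕ → Ω → ℂ) (f₀ : Ω → ℂ) (hf : ∀ n, f n ∈ HInfty Ω) (hf₀ : f₀ ∈ HInfty Ω),
    (∃ K : ℝ, ∀ n z, ‖f n z‖ ≤ K) → (∀ z, Tendsto (fun n => f n z) atTop (𝓝 (f₀ z))) →
    ∀ (x : X) (x' : StrongDual ℂ X),
      Tendsto (fun n => x' (C.Φ ⟨(e : Ω → ℂ) * f n, mul_mem _ (hf n)⟩ x)) atTop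
        (𝓝 (x' (C.Φ ⟨(e : Ω → ℂ) * f₀, mul_mem _ hf₀⟩ x)))
  injective : Function.Injective (C.Φ e)

end SquareFn

end

/-! Trace duality makes the adjoint of a bounded `Φ_γ'(f)` act on `γ(H;X)`, a priori with values in
`X''`. The proof shows that the values lie in `X` and identifies them on the range of `Φ_γ(g)`.

Values in `X`: since `Φ_γ'(f)` is defined everywhere, each closed, densely defined `Φ(⟨f, h'⟩)` has
an everywhere defined adjoint, so by uniform boundedness it is itself defined everywhere
(`domain_eq_top_of_adjoint`). The adjoint therefore sends a finite rank operator `∑ g_j ⊗ x_j` to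
the point `∑ Φ(⟨f, g_j⟩) x_j` of `X`. Finite rank operators are `γ`-dense and the `γ'`-bound is
uniform, so the images of approximants converge in `X` (`exists_represents_trace`).

Identification: let `U = Φ_γ(g) x`, let `y` be its image, and test against `x' ∘ Φ(e)`. The `i`-th
diagonal term of the trace is `x'(Φ(e p_i) x)`, where `p_i` is the `i`-th term of `⟨f, g⟩ = ∑ p_i`
in coordinates. The partial sums of the `p_i` are uniformly bounded and converge pointwise, so the
weak continuity of `Φ(e ·)` gives `x'(Φ(e) y) = x'(Φ(e⟨f, g⟩) x)` (`mem_graph_Phi_pairing`).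
Continuity holds only along sequences, whereas `H` may be non-separable; the separability of `Ω`
leaves only countably many nonzero coordinates of `f`. -/

namespace SquareFn

/-! ### Projections, finite rank operators and finite traces -/

section GammaIdeal

variable {H X : Type*} [NormedAddCommGroup H] [InnerProductSpace ℂ H]
  [NormedAddCommGroup X] [NormedSpace ℂ X]

theorem gammaNorm_neg (T : H →L[ℂ] X) : gammaNorm (-T) ≤ gammaNorm T := by
  simpa using gammaNorm_smul_le (-1 : ℂ) T

theorem gammaNorm_sub_le (S T : H →L[ℂ] X) :
    gammaNorm (S - T) ≤ gammaNorm S + gammaNorm T := by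
  rw [sub_eq_add_neg]
  exact (gammaNorm_add_le _ _).trans (by gcongr; exact gammaNorm_neg T)

theorem gammaNorm_comp_isometry_le (T : H →L[ℂ] X) (R : H →ₗᵢ[ℂ] H) :
    gammaNorm (T.comp R.toContinuousLinearMap) ≤ gammaNorm T := by
  refine iSup_le fun n => iSup_le fun e => iSup_le fun he => ?_
  exact le_iSup_of_le n (le_iSup_of_le (R ∘ e) (le_iSup_of_le (he.comp_linearIsometry R) le_rfl))

/-- Composition with an orthogonal projection `P` does not increase the `γ`-norm, since `P` is the
mean of the identity and a reflection. -/
theorem gammaNorm_comp_starProjection_le (T : H →L[ℂ] X) (K : Submodule ℂ H)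
    [K.HasOrthogonalProjection] : gammaNorm (T.comp K.starProjection) ≤ gammaNorm T := by
  have h : T.comp K.starProjection =
      (2⁻¹ : ℂ) • (T + T.comp K.reflection.toLinearIsometry.toContinuousLinearMap) := by
    ext v
    simp only [ContinuousLinearMap.comp_apply, smul_apply, add_apply,
      LinearIsometry.coe_toContinuousLinearMap, LinearIsometryEquiv.coe_toLinearIsometry,
      Submodule.reflection_apply, map_sub, two_smul, map_add, smul_add, smul_sub]
    module
  rw [h]
  refine (gammaNorm_smul_le _ _).trans ?_
  have h2 : gammaNorm (T + T.comp K.reflection.toLinearIsometry.toContinuousLinearMap)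
      ≤ 2 * gammaNorm T := by
    rw [two_mul]
    exact (gammaNorm_add_le _ _).trans (by gcongr; exact gammaNorm_comp_isometry_le _ _)
  refine (mul_le_mul_right h2 _).trans ?_
  have h3 : ‖(2⁻¹ : ℂ)‖ₑ = 2⁻¹ := by
    rw [enorm_inv (by norm_num)]
    congr 1
    simp [enorm_eq_nnnorm]
  rw [h3, ← mul_assoc, ENNReal.inv_mul_cancel (by norm_num) (by norm_num), one_mul]

theorem starProjection_span_image {ι : Type*} {b : ι → H} (hb : Orthonormal ℂ b) (s : Finset ι) :
    ∃ (K : Submodule ℂ H) (_ : K.HasOrthogonalProjection),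
      ∀ v, K.starProjection v = ∑ i ∈ s, inner ℂ (b i) v • b i := by
  classical
  have hfd : FiniteDimensional ℂ (Submodule.span ℂ (b '' s)) :=
    FiniteDimensional.span_of_finite ℂ (s.finite_toSet.image b)
  refine ⟨Submodule.span ℂ (b '' s), inferInstance, fun v => ?_⟩
  refine Submodule.eq_starProjection_of_mem_of_inner_eq_zero ?_ fun w hw => ?_
  · exact Submodule.sum_mem _ fun i hi =>
      Submodule.smul_mem _ _ (Submodule.subset_span ⟨i, hi, rfl⟩)
  · induction hw using Submodule.span_induction with
    | mem w hw =>
      obtain ⟨i, hi, rfl⟩ := hw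
      rw [inner_sub_left, sum_inner, Finset.sum_eq_single_of_mem i hi]
      · simp [inner_smul_left, hb.1]
      · intro j _ hj
        rw [inner_smul_left, hb.2 hj, mul_zero]
    | zero => simp
    | add u w _ _ hu hw => rw [inner_add_right, hu, hw, add_zero]
    | smul c w _ hw => rw [inner_smul_right, hw, mul_zero]

theorem norm_sum_inner_smul_le {ι : Type*} {b : ι → H} (hb : Orthonormal ℂ b) (s : Finset ι)
    (v : H) : ‖∑ i ∈ s, inner ℂ (b i) v • b i‖ ≤ ‖v‖ := by
  obtain ⟨K, _, hK⟩ := starProjection_span_image hb s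
  rw [← hK]
  exact (K.starProjection.le_opNorm v).trans
    (mul_le_of_le_one_left (norm_nonneg _) K.starProjection_norm_le)

/-- A finite rank operator is a sum of elementary tensors. -/
theorem IsFiniteRank.exists_sum_smulRight {S : H →L[ℂ] X} (hS : IsFiniteRank S) :
    ∃ (n : ℕ) (g : Fin n → StrongDual ℂ H) (x : Fin n → X), S = ∑ j, (g j).smulRight (x j) := by
  unfold IsFiniteRank at hS
  let B := Module.finBasis ℂ (LinearMap.range (S : H →ₗ[ℂ] X))
  let S' : H →L[ℂ] LinearMap.range (S : H →ₗ[ℂ] X) := S.codRestrict _ fun h => ⟨h, rfl⟩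
  refine ⟨_, fun j => (LinearMap.toContinuousLinearMap (B.coord j)).comp S',
    fun j => (B j : X), ?_⟩
  ext h
  have := congrArg (Subtype.val) (B.sum_repr (S' h))
  simp only [sum_apply, ContinuousLinearMap.smulRight_apply,
    ContinuousLinearMap.comp_apply, LinearMap.coe_toContinuousLinearMap', Module.Basis.coord_apply]
  rw [Submodule.coe_sum] at this
  exact this.symm

theorem sum_eq_sum_equivFin {ι M : Type*} [AddCommMonoid M] (s : Finset ι) (φ : ι → M) :
    ∑ j ∈ s, φ j = ∑ k : Fin s.card, φ (s.equivFin.symm k) := by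
  rw [← Finset.sum_coe_sort]
  exact (Equiv.sum_comp s.equivFin.symm (fun i : s => φ i)).symm

/-- Scaling of the definition of the `γ'`-norm. A positive bound `r` replaces the `γ`-norm itself,
which may vanish. -/
theorem enorm_trace_le (V : StrongDual ℂ H →L[ℂ] StrongDual ℂ X) {ι : Type*} (s : Finset ι)
    (g : ι → StrongDual ℂ H) (x : ι → X) {r : ℝ≥0} (hr : 0 < r)
    (h : gammaNorm (∑ j ∈ s, (g j).smulRight (x j)) ≤ r) :
    ‖∑ j ∈ s, V (g j) (x j)‖ₑ ≤ gammaDualNorm V * r := by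
  have hr' : (r : ℂ) ≠ 0 := by exact_mod_cast hr.ne'
  have hre : ‖(r : ℂ)‖ₑ = r := by simp [enorm_eq_nnnorm]
  have key : ‖∑ j ∈ s, V (g j) ((r : ℂ)⁻¹ • x j)‖ₑ ≤ gammaDualNorm V := by
    rw [sum_eq_sum_equivFin]
    refine le_iSup_of_le s.card (le_iSup_of_le (fun k => g (s.equivFin.symm k))
      (le_iSup_of_le (fun k => (r : ℂ)⁻¹ • x (s.equivFin.symm k)) (le_iSup_of_le ?_ le_rfl)))
    have h1 : ∑ k : Fin s.card, (g (s.equivFin.symm k)).smulRight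
        ((r : ℂ)⁻¹ • x (s.equivFin.symm k)) = (r : ℂ)⁻¹ • ∑ j ∈ s, (g j).smulRight (x j) := by
      rw [sum_eq_sum_equivFin s, Finset.smul_sum]
      refine Finset.sum_congr rfl fun k _ => ?_
      ext v
      exact smul_comm _ _ _
    rw [h1]
    refine (gammaNorm_smul_le _ _).trans ((mul_le_mul_right h _).trans ?_)
    rw [enorm_inv hr', hre, ENNReal.inv_mul_cancel (by exact_mod_cast hr.ne') (by simp)]
  have h2 : ∑ j ∈ s, V (g j) (x j) = (∑ j ∈ s, V (g j) ((r : ℂ)⁻¹ • x j)) * (r : ℂ) := by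
    rw [Finset.sum_mul]
    refine Finset.sum_congr rfl fun j _ => ?_
    rw [map_smul, smul_eq_mul]
    field_simp
  rw [h2, enorm_mul, hre]
  gcongr

theorem sum_smulRight_basis_eq {ι : Type*} {b : ι → H} (U : H →L[ℂ] X) (s : Finset ι)
    {K : Submodule ℂ H} [K.HasOrthogonalProjection]
    (hK : ∀ v, K.starProjection v = ∑ i ∈ s, inner ℂ (b i) v • b i) :
    ∑ i ∈ s, (innerSL ℂ (b i)).smulRight (U (b i)) = U.comp K.starProjection := by
  ext v
  simp [hK, sum_apply, map_sum]

/-- A partial sum of the trace is the trace against `U ∘ P`, with `P` the projection onto finitely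
many basis vectors, and `P` does not increase the `γ`-norm. The bound is uniform in `s`, which is
what makes approximation of the trace possible. -/
theorem enorm_partial_trace_le {ι : Type*} {b : ι → H} (hb : Orthonormal ℂ b) (U : H →L[ℂ] X)
    (V : StrongDual ℂ H →L[ℂ] StrongDual ℂ X) (s : Finset ι) {r : ℝ≥0} (hr : 0 < r)
    (h : gammaNorm U ≤ r) :
    ‖∑ i ∈ s, V (innerSL ℂ (b i)) (U (b i))‖ₑ ≤ gammaDualNorm V * r := by
  obtain ⟨K, _, hK⟩ := starProjection_span_image hb s
  refine enorm_trace_le V s _ _ hr ?_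
  rw [sum_smulRight_basis_eq U s hK]
  exact (gammaNorm_comp_starProjection_le U K).trans h

end GammaIdeal

/-! ### Convergence and size of the trace -/

section TraceDuality

universe u v

variable {H : Type u} [NormedAddCommGroup H] [InnerProductSpace ℂ H] [CompleteSpace H]
  {X : Type v} [NormedAddCommGroup X] [NormedSpace ℂ X]

/-- By the Riesz isomorphism, each functional `φ` is the norm convergent sum of `φ (b i) • innerSL ℂ
(b i)`; the continuous map `V`, followed by evaluation at `x j`, preserves the sum. -/
theorem hasSum_trace_of_smulRight (V : StrongDual ℂ H →L[ℂ] StrongDual ℂ X) {ι : Type*}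
    (b : HilbertBasis ι ℂ H) {n : ℕ} (g : Fin n → StrongDual ℂ H) (x : Fin n → X) :
    HasSum (fun i => V (innerSL ℂ (b i)) ((∑ j, (g j).smulRight (x j)) (b i)))
      (∑ j, V (g j) (x j)) := by
  have h1 : ∀ φ : StrongDual ℂ H, HasSum (fun i => φ (b i) • innerSL ℂ (b i)) φ := fun φ => by
    obtain ⟨w, rfl⟩ := (InnerProductSpace.toDual ℂ H).surjective φ
    have h := (b.hasSum_repr w).map (InnerProductSpace.toDual ℂ H)
      (InnerProductSpace.toDual ℂ H).continuous
    have h' : (InnerProductSpace.toDual ℂ H ∘ fun i => b.repr w i • b i) =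
        fun i => InnerProductSpace.toDual ℂ H w (b i) • innerSL ℂ (b i) := by
      funext i
      rw [Function.comp_apply, map_smulₛₗ, b.repr_apply_apply, inner_conj_symm]
      rfl
    rwa [h'] at h
  simp only [sum_apply, ContinuousLinearMap.smulRight_apply, map_sum]
  refine hasSum_sum fun j _ => ?_
  have h2 := ((h1 (g j)).mapL V).mapL (ContinuousLinearMap.apply ℂ ℂ (x j))
  simpa only [map_smul, ContinuousLinearMap.apply_apply, smul_apply, smul_eq_mul] using h2

/-- Trace duality can be computed by approximation with finite rank operators. -/
theorem hasSum_trace_of_approx {U : H →L[ℂ] X} {V : StrongDual ℂ H →L[ℂ] StrongDual ℂ X}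
    (hV : gammaDualNorm V < ∞) {t : ℂ}
    (h : ∀ ε : ℝ≥0, 0 < ε → ∃ (n : ℕ) (g : Fin n → StrongDual ℂ H) (x : Fin n → X),
      gammaNorm (U - ∑ j, (g j).smulRight (x j)) ≤ ε ∧ ‖∑ j, V (g j) (x j) - t‖ ≤ ε)
    {ι : Type*} (b : HilbertBasis ι ℂ H) :
    HasSum (fun i => V (innerSL ℂ (b i)) (U (b i))) t := by
  obtain ⟨M, hM⟩ : ∃ M : ℝ≥0, gammaDualNorm V = M := ⟨_, (ENNReal.coe_toNNReal hV.ne).symm⟩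
  rw [HasSum, Metric.tendsto_nhds]
  intro ε hε
  -- The remainder contributes at most `M * δ`, the finite rank trace and its distance to `t` at
  -- most `δ` each; the spare third `δ` gives the strict inequality.
  let δ : ℝ≥0 := ⟨ε / (M + 3), by positivity⟩
  have hδ : 0 < δ := by
    change 0 < ε / ((M : ℝ) + 3)
    positivity
  obtain ⟨n, g, x, h1, h2⟩ := h δ hδ
  filter_upwards [(Metric.tendsto_nhds.1 (hasSum_trace_of_smulRight V b g x)) δ hδ] with s hs
  have h3 := enorm_partial_trace_le b.orthonormal _ V s hδ h1
  rw [hM, ← ENNReal.coe_mul, enorm_eq_nnnorm, ENNReal.coe_le_coe] at h3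
  have h3' : ‖∑ i ∈ s, V (innerSL ℂ (b i)) ((U - ∑ j, (g j).smulRight (x j)) (b i))‖ ≤ M * δ := h3
  simp only [sub_apply, map_sub, Finset.sum_sub_distrib] at h3'
  rw [dist_eq_norm] at hs ⊢
  have h4 : (M : ℝ) * δ + δ + δ < ε := by
    have : (δ : ℝ) * (M + 3) = ε := div_mul_cancel₀ _ (by positivity)
    have : (0 : ℝ) < δ := hδ
    nlinarith
  refine lt_of_le_of_lt ?_ h4
  refine le_trans (le_of_eq ?_) ((norm_add₃_le).trans (add_le_add_three h3' hs.le h2))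
  congr 1
  ring

theorem HasTraceDuality.enorm_le {U : gammaRad H X} {V : gammaDual H X} {t : ℂ}
    (ht : HasTraceDuality U V t) : ‖t‖ₑ ≤ gammaDualNorm V.1 * gammaNorm U.1 := by
  obtain ⟨w, b, _⟩ := exists_hilbertBasis ℂ H
  have hU : gammaNorm U.1 < ∞ := U.2.1
  have hV : gammaDualNorm V.1 < ∞ := V.2
  have hle : ∀ r : ℝ≥0, 0 < r → gammaNorm U.1 ≤ r → ‖t‖ₑ ≤ gammaDualNorm V.1 * r := fun r hr h =>
    le_of_tendsto ((continuous_enorm.tendsto t).comp (ht w b))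
      (Eventually.of_forall fun s => enorm_partial_trace_le b.orthonormal U.1 V.1 s hr h)
  obtain ⟨c, hc⟩ : ∃ c : ℝ≥0, gammaNorm U.1 = c := ⟨_, (ENNReal.coe_toNNReal hU.ne).symm⟩
  obtain ⟨M, hM⟩ : ∃ M : ℝ≥0, gammaDualNorm V.1 = M := ⟨_, (ENNReal.coe_toNNReal hV.ne).symm⟩
  rw [hc, hM]
  -- The bound is available only for `r > 0`, so the possible value `c = 0` is approached from the
  -- right.
  have hlim : Tendsto (fun r : ℝ≥0 => (M : ℝ≥0∞) * r) (𝓝[>] c) (𝓝 (M * c)) := by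
    simp only [← ENNReal.coe_mul]
    refine ENNReal.tendsto_coe.2 (Tendsto.mono_left ?_ nhdsWithin_le_nhds)
    exact (continuous_const.mul continuous_id).tendsto c
  refine ge_of_tendsto hlim ?_
  filter_upwards [self_mem_nhdsWithin] with r hr
  refine hM ▸ hle r ((zero_le).trans_lt hr) (hc ▸ ENNReal.coe_le_coe.2 (le_of_lt hr))

end TraceDuality

/-! ### Uniform boundedness and adjoints with values in `X` -/

/-- A weakly bounded family in a normed space is bounded. -/
theorem exists_norm_le_of_weakly_bounded {X : Type*} [NormedAddCommGroup X] [NormedSpace ℂ X]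
    {ι : Type*} {u : ι → X} (h : ∀ x' : StrongDual ℂ X, ∃ C : ℝ, ∀ i, ‖x' (u i)‖ ≤ C) :
    ∃ C : ℝ, ∀ i, ‖u i‖ ≤ C := by
  -- Points of `X` act as functionals on its dual, which is complete even when `X` is not.
  obtain ⟨C, hC⟩ := banach_steinhaus (g := fun i => NormedSpace.inclusionInDoubleDual ℂ X (u i)) h
  refine ⟨C, fun i => ?_⟩
  rw [← (NormedSpace.inclusionInDoubleDualLi (E := X) ℂ).norm_map]
  exact hC i

/-- A closed densely defined operator whose adjoint is defined everywhere is itself defined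
everywhere. -/
theorem domain_eq_top_of_adjoint {X : Type*} [NormedAddCommGroup X] [NormedSpace ℂ X]
    [CompleteSpace X] (A : X →ₗ.[ℂ] X) (hcl : IsClosed (A.graph : Set (X × X)))
    (hd : Dense (A.domain : Set X))
    (hA : ∀ x' : StrongDual ℂ X, ∃ z' : StrongDual ℂ X, ∀ x : A.domain, x' (A x) = z' x) :
    A.domain = ⊤ := by
  obtain ⟨C, hC⟩ := exists_norm_le_of_weakly_bounded
    -- The family `A x / ‖x‖`, with value `0` at `x = 0`: the adjoint bounds it weakly by `‖z'‖`.
    (u := fun x : A.domain => ((‖(x : X)‖⁻¹ : ℝ) : ℂ) • A x) fun x' => by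
      obtain ⟨z', hz'⟩ := hA x'
      refine ⟨‖z'‖, fun x => ?_⟩
      rw [map_smul, hz', norm_smul, Complex.norm_real, norm_inv, norm_norm]
      rcases eq_or_ne ‖(x : X)‖ 0 with h0 | h0
      · simp [h0]
      · rw [inv_mul_le_iff₀ (lt_of_le_of_ne (norm_nonneg _) (Ne.symm h0)), mul_comm]
        exact z'.le_opNorm _
  have hb : ∀ x : A.domain, ‖A.toFun x‖ ≤ C * ‖A.domain.subtype x‖ := fun x => by
    rcases eq_or_ne (x : X) 0 with h0 | h0
    · have : x = 0 := Subtype.ext h0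
      simp [this]
    · have h1 := hC x
      have hpos : 0 < ‖(x : X)‖ := norm_pos_iff.2 h0
      rw [norm_smul, Complex.norm_real, norm_inv, norm_norm, inv_mul_le_iff₀ hpos, mul_comm] at h1
      exact h1
  have hdr : DenseRange A.domain.subtype := by
    rw [DenseRange]
    simpa using hd
  -- The bounded operator extends continuously to `X`; as the graph is closed, it contains the graph
  -- of the extension.
  have hext : ∀ x : X, (x, A.toFun.extendOfNorm A.domain.subtype x) ∈ A.graph := fun x => by
    have hc : IsClosed {x : X | (x, A.toFun.extendOfNorm A.domain.subtype x) ∈ A.graph} :=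
      hcl.preimage (f := fun x => (x, A.toFun.extendOfNorm A.domain.subtype x)) (by fun_prop)
    refine (hc.closure_subset_iff.2 fun x hx => ?_) (hd x)
    have h := LinearMap.extendOfNorm_eq hdr ⟨C, hb⟩ ⟨x, hx⟩
    change (x, _) ∈ A.graph
    rw [Submodule.subtype_apply] at h
    rw [h]
    exact A.mem_graph ⟨x, hx⟩
  exact eq_top_iff.2 fun x _ => LinearPMap.mem_domain_of_mem_graph (hext x)

/-- If `V x' ∈ γ'(H';X')` is bounded in `x'` and each `x' ↦ ⟨x, V x' h'⟩` is represented by a point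
of `X`, then so is `x' ↦ ⟨U, V x'⟩` for every `U ∈ γ(H;X)`. -/
theorem exists_represents_trace {H X : Type*} [NormedAddCommGroup H] [InnerProductSpace ℂ H]
    [CompleteSpace H] [NormedAddCommGroup X] [NormedSpace ℂ X] [CompleteSpace X]
    (V : StrongDual ℂ X → gammaDual H X) (K : ℝ≥0)
    (hK : ∀ x', gammaDualNorm (V x').1 ≤ K * ‖x'‖ₑ)
    (hV : ∀ (h' : StrongDual ℂ H) (x : X), ∃ y : X, ∀ x', x' y = (V x').1 h' x)
    (U : gammaRad H X) : ∃ y : X, ∀ x', HasTraceDuality U (V x') (x' y) := by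
  choose A hA using hV
  have hδ : ∀ n : ℕ, (0 : ℝ≥0) < (1 / 2) ^ n := fun n => by positivity
  have happ : ∀ n : ℕ, ∃ (m : ℕ) (g : Fin m → StrongDual ℂ H) (x : Fin m → X),
      gammaNorm (U.1 - ∑ j, (g j).smulRight (x j)) ≤ ((1 / 2) ^ n : ℝ≥0) := fun n => by
    obtain ⟨S, hS, hUS⟩ := U.2.2 ((1 / 2) ^ n : ℝ≥0) (ENNReal.coe_pos.2 (hδ n))
    obtain ⟨m, g, x, rfl⟩ := hS.exists_sum_smulRight
    exact ⟨m, g, x, hUS.le⟩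
  choose m g x hx using happ
  let y : ℕ → X := fun n => ∑ j, A (g n j) (x n j)
  have hy : ∀ n (x' : StrongDual ℂ X), x' (y n) = ∑ j, (V x').1 (g n j) (x n j) := fun n x' => by
    simp only [y, map_sum, hA]
  have hdist : ∀ n k, ‖y n - y k‖ ≤ K * ((1 / 2) ^ n + (1 / 2) ^ k : ℝ≥0) := fun n k => by
    refine NormedSpace.norm_le_dual_bound ℂ _ (by positivity) fun x' => ?_
    -- `x' (y n - y k)` is the trace against the difference of two approximants of `U`, written as
    -- one sum over a disjoint union; the difference has `γ`-norm at most the sum of the two errors.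
    have h := enorm_trace_le (V x').1 Finset.univ (Sum.elim (g n) (g k))
      (Sum.elim (x n) (fun j => -x k j)) (r := (1 / 2) ^ n + (1 / 2) ^ k) (by positivity) (by
        have : ∑ j, ((Sum.elim (g n) (g k)) j).smulRight ((Sum.elim (x n) (fun j => -x k j)) j)
            = (U.1 - ∑ j, (g k j).smulRight (x k j)) - (U.1 - ∑ j, (g n j).smulRight (x n j)) := by
          rw [sub_sub_sub_cancel_left, Fintype.sum_sum_type, sub_eq_add_neg, ← Finset.sum_neg_distrib]
          congr 1
          refine Finset.sum_congr rfl fun j _ => ?_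
          ext v
          simp
        rw [this, ENNReal.coe_add, add_comm]
        exact (gammaNorm_sub_le _ _).trans (add_le_add (hx k) (hx n)))
    rw [Fintype.sum_sum_type] at h
    simp only [Sum.elim_inl, Sum.elim_inr, map_neg, Finset.sum_neg_distrib, ← hy] at h
    rw [← sub_eq_add_neg, ← map_sub] at h
    have h2 := h.trans (mul_le_mul_left (hK x') _)
    rw [enorm_eq_nnnorm, enorm_eq_nnnorm, ← ENNReal.coe_mul, ← ENNReal.coe_mul,
      ENNReal.coe_le_coe] at h2
    have h3 : ‖x' (y n - y k)‖ ≤ K * ‖x'‖ * ((1 / 2) ^ n + (1 / 2) ^ k : ℝ≥0) := by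
      exact_mod_cast h2
    linarith
  have hanti : ∀ {n k : ℕ}, n ≤ k → ((1 / 2 : ℝ) ^ k) ≤ (1 / 2) ^ n := fun h =>
    pow_le_pow_of_le_one (by norm_num) (by norm_num) h
  have h0 : Tendsto (fun n : ℕ => (1 / 2 : ℝ) ^ n) atTop (𝓝 0) :=
    tendsto_pow_atTop_nhds_zero_of_lt_one (by norm_num) (by norm_num)
  have hc : CauchySeq y := by
    refine cauchySeq_of_le_tendsto_0' (fun n => K * (2 * (1 / 2 : ℝ) ^ n)) (fun n k hnk => ?_) ?_
    · rw [dist_eq_norm]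
      refine (hdist n k).trans ?_
      push_cast
      gcongr
      linarith [hanti hnk]
    · simpa using (h0.const_mul 2).const_mul (K : ℝ)
  obtain ⟨z, hz⟩ := cauchySeq_tendsto_of_complete hc
  refine ⟨z, fun x' ι b => hasSum_trace_of_approx (V x').2 (fun ε hε => ?_) b⟩
  have h1 : ∀ᶠ n in atTop, (1 / 2 : ℝ) ^ n < ε := h0.eventually (gt_mem_nhds hε)
  have h2 : ∀ᶠ n in atTop, dist (x' (y n)) (x' z) < ε :=
    Metric.tendsto_nhds.1 ((x'.continuous.tendsto z).comp hz) ε hε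
  obtain ⟨n, hn1, hn2⟩ := (h1.and h2).exists
  refine ⟨m n, g n, x n, (hx n).trans (ENNReal.coe_le_coe.2 ?_), ?_⟩
  · exact_mod_cast hn1.le
  · rw [← hy, ← dist_eq_norm]
    exact hn2.le

/-! ### Graphs of adjoints, square functions and products -/

section Graphs

variable {X : Type*} [NormedAddCommGroup X] [NormedSpace ℂ X]

theorem mem_graph_adjointOp {A : X →ₗ.[ℂ] X} (hd : Dense (A.domain : Set X))
    {x' z' : StrongDual ℂ X} :
    (x', z') ∈ (adjointOp A).graph ↔ ∀ x : A.domain, x' (A x) = z' x := by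
  rw [adjointOp, Submodule.toLinearPMap_graph_eq]
  · rfl
  · rintro ⟨p, q⟩ hp hp0
    have hp0 : p = 0 := hp0
    have hq : ∀ x : A.domain, p (A x) = q x := hp
    refine ContinuousLinearMap.ext fun x => ?_
    have hc : IsClosed {x : X | q x = 0} := isClosed_eq q.continuous continuous_const
    exact (hc.closure_subset_iff.2 fun x hx => by
      change q x = 0
      rw [← hq ⟨x, hx⟩, hp0, zero_apply]) (hd x)

namespace FunctionalCalculus

variable {S : Type*} {F : Subalgebra ℂ (S → ℂ)} (C : FunctionalCalculus F X)
  {H : Type*} [NormedAddCommGroup H] [InnerProductSpace ℂ H]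

theorem mem_graph_PhiGamma {g : S → StrongDual ℂ H} {x : X} {U : gammaRad H X} :
    (x, U) ∈ (C.PhiGamma g).graph ↔ ∀ h, (x, U.1 h) ∈ (C.Phi fun z => g z h).graph := by
  rw [PhiGamma, Submodule.toLinearPMap_graph_eq]
  · rfl
  · rintro ⟨x, U⟩ hp hx
    refine Subtype.ext (ContinuousLinearMap.ext fun h => ?_)
    have hp : ∀ h, (x, U.1 h) ∈ (C.Phi fun z => g z h).graph := hp
    exact LinearPMap.graph_fst_eq_zero_snd _ (hp h) hx

theorem mem_graph_PhiGammaDual {f : S → H} {x' : StrongDual ℂ X} {V : gammaDual H X} :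
    (x', V) ∈ (C.PhiGammaDual f).graph ↔
      ∀ h', (x', V.1 h') ∈ (adjointOp (C.Phi fun z => h' (f z))).graph := by
  rw [PhiGammaDual, Submodule.toLinearPMap_graph_eq]
  · rfl
  · rintro ⟨x', V⟩ hp hx
    refine Subtype.ext (ContinuousLinearMap.ext fun h' => ?_)
    have hp : ∀ h', (x', V.1 h') ∈ (adjointOp (C.Phi fun z => h' (f z))).graph := hp
    exact LinearPMap.graph_fst_eq_zero_snd _ (hp h') hx

theorem isClosed_graph_Phi {f : S → ℂ} {e : C.E} (he : C.IsRegulariser e f) :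
    IsClosed ((C.Phi f).graph : Set (X × X)) := by
  have : ((C.Phi f).graph : Set (X × X)) =
      {p | C.Φ e p.2 = C.Φ ⟨(e : S → ℂ) * f, he.1⟩ p.1} :=
    Set.ext fun p => C.mem_graph_Phi_iff he p.1 p.2
  rw [this]
  exact isClosed_eq (by fun_prop) (by fun_prop)

/-- With one regulariser `e` for all three functions, both sides agree after a further `Φ(e)`:
`Φ(e)Φ(e)z = Φ(ef)Φ(e)y = Φ(ef)Φ(eg)x = Φ(e)Φ(efg)x`. Injectivity of `Φ(e)` removes the extra
factor. -/
theorem mem_graph_Phi_mul {f g : S → ℂ} {e : C.E} (hef : C.IsRegulariser e f)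
    (heg : C.IsRegulariser e g) (hefg : C.IsRegulariser e (f * g)) {x y z : X}
    (hg : (x, y) ∈ (C.Phi g).graph) (hf : (y, z) ∈ (C.Phi f).graph) :
    (x, z) ∈ (C.Phi (f * g)).graph := by
  rw [C.mem_graph_Phi_iff heg] at hg
  rw [C.mem_graph_Phi_iff hef] at hf
  rw [C.mem_graph_Phi_iff hefg]
  refine hef.2 ?_
  have h1 : C.Φ e (C.Φ ⟨(e : S → ℂ) * f, hef.1⟩ y) = C.Φ ⟨(e : S → ℂ) * f, hef.1⟩ (C.Φ e y) := by
    rw [← mul_apply_eq_comp, ← mul_apply_eq_comp, ← map_mul, ← map_mul]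
    congr 2
    exact Subtype.ext (mul_comm _ _)
  have h2 : C.Φ ⟨(e : S → ℂ) * f, hef.1⟩ (C.Φ ⟨(e : S → ℂ) * g, heg.1⟩ x) =
      C.Φ e (C.Φ ⟨(e : S → ℂ) * (f * g), hefg.1⟩ x) := by
    rw [← mul_apply_eq_comp, ← mul_apply_eq_comp, ← map_mul, ← map_mul]
    congr 2
    refine Subtype.ext ?_
    change ((e : S → ℂ) * f) * (e * g) = e * (e * (f * g))
    ring
  change C.Φ e (C.Φ e z) = C.Φ e (C.Φ ⟨(e : S → ℂ) * (f * g), hefg.1⟩ x)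
  rw [hf, h1, hg, h2]

variable {C} in
/-- If `Φ_γ'(f)` is everywhere defined, then so are all the operators `Φ(⟨f, h'⟩)`. -/
theorem domain_Phi_eq_top [CompleteSpace X] {f : S → H} (hfd : C.DualWellDefined f)
    (htop : (C.PhiGammaDual f).domain = ⊤) (h' : StrongDual ℂ H) {e : C.E}
    (he : C.IsRegulariser e fun z => h' (f z)) : (C.Phi fun z => h' (f z)).domain = ⊤ := by
  refine domain_eq_top_of_adjoint _ (C.isClosed_graph_Phi he) (hfd h') fun x' => ?_
  have h := (C.PhiGammaDual f).mem_graph ⟨x', htop ▸ Submodule.mem_top⟩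
  exact ⟨_, (mem_graph_adjointOp (hfd h')).1 (C.mem_graph_PhiGammaDual.1 h h')⟩

end FunctionalCalculus

end Graphs

/-! ### Bounded pointwise limits in `H^∞(Ω)` and countable sums -/

/-- A bounded pointwise limit of holomorphic functions is holomorphic. -/
theorem differentiableOn_of_bounded_tendsto {Ω : Set ℂ} (hΩ : IsOpen Ω) {s : ℕ → ℂ → ℂ}
    {s₀ : ℂ → ℂ} (hs : ∀ n, DifferentiableOn ℂ (s n) Ω) {K : ℝ} (hK : ∀ n, ∀ z ∈ Ω, ‖s n z‖ ≤ K)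
    (hlim : ∀ z ∈ Ω, Tendsto (fun n => s n z) atTop (𝓝 (s₀ z))) : DifferentiableOn ℂ s₀ Ω := by
  intro c hc
  obtain ⟨R, hR, hRΩ⟩ := Metric.nhds_basis_closedBall.mem_iff.1 (hΩ.mem_nhds hc)
  lift R to ℝ≥0 using hR.le
  have hR0 : (0 : ℝ≥0) < R := by exact_mod_cast hR
  have hmem : ∀ θ, circleMap c R θ ∈ Ω := fun θ => hRΩ (circleMap_mem_closedBall c hR.le θ)
  have hcont : ∀ n, Continuous fun θ => s n (circleMap c R θ) := fun n =>
    (hs n).continuousOn.comp_continuous (continuous_circleMap c R) hmem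
  have hmeas : AEStronglyMeasurable (fun θ => s₀ (circleMap c R θ)) volume :=
    aestronglyMeasurable_of_tendsto_ae atTop (fun n => (hcont n).aestronglyMeasurable)
      (Eventually.of_forall fun θ => hlim _ (hmem θ))
  have hbd : ∀ θ, ‖s₀ (circleMap c R θ)‖ ≤ K := fun θ =>
    le_of_tendsto (hlim _ (hmem θ)).norm (Eventually.of_forall fun n => hK n _ (hmem θ))
  have hci : CircleIntegrable s₀ c R := by
    refine (intervalIntegrable_const (c := K)).mono_fun hmeas.restrict ?_
    exact Eventually.of_forall fun θ => (hbd θ).trans (le_abs_self K)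
  -- The Cauchy formula passes from `s n` to `s₀` by dominated convergence; it then represents `s₀`
  -- near `c` by a power series.
  have hcauchy : ∀ w ∈ Metric.ball c (R : ℝ),
      ((2 * Real.pi * Complex.I : ℂ)⁻¹ • ∮ z in C(c, R), (z - w)⁻¹ • s₀ z) = s₀ w := fun w hw => by
    refine tendsto_nhds_unique ?_ (hlim w (hRΩ (Metric.ball_subset_closedBall hw)))
    have h1 : ∀ n, s n w = (2 * Real.pi * Complex.I : ℂ)⁻¹ •
        ∮ z in C(c, R), (z - w)⁻¹ • s n z := fun n =>
      (Complex.two_pi_I_inv_smul_circleIntegral_sub_inv_smul_of_differentiable_on_off_countable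
        Set.countable_empty hw ((hs n).continuousOn.mono hRΩ) fun z hz =>
          (hs n).differentiableAt (hΩ.mem_nhds
            (hRΩ (Metric.ball_subset_closedBall hz.1)))).symm
    simp only [h1]
    refine Tendsto.const_smul ?_ _
    have hne : ∀ θ, circleMap c R θ - w ≠ 0 := fun θ h0 => by
      have : w ∈ Metric.sphere c (R : ℝ) := by
        rw [← sub_eq_zero.1 h0]
        exact circleMap_mem_sphere c hR.le θ
      exact (Metric.mem_ball.1 hw).ne (Metric.mem_sphere.1 this)
    have hker : Continuous fun θ => deriv (circleMap c R) θ • (circleMap c R θ - w)⁻¹ := by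
      simp only [deriv_circleMap]
      have h2 : Continuous fun θ => (circleMap c R θ - w)⁻¹ :=
        ((continuous_circleMap c R).sub continuous_const).inv₀ hne
      exact ((continuous_circleMap 0 R).mul continuous_const).smul h2
    refine intervalIntegral.tendsto_integral_filter_of_dominated_convergence
      (fun θ => ‖deriv (circleMap c R) θ • (circleMap c R θ - w)⁻¹‖ * K) ?_ ?_ ?_ ?_
    · refine Eventually.of_forall fun n => ?_
      simp only [← smul_assoc]
      exact (hker.smul (hcont n)).aestronglyMeasurable
    · refine Eventually.of_forall fun n => Eventually.of_forall fun θ _ => ?_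
      rw [← smul_assoc, norm_smul]
      gcongr
      exact hK n _ (hmem θ)
    · exact (hker.norm.mul continuous_const).intervalIntegrable _ _
    · refine Eventually.of_forall fun θ _ => ?_
      exact ((hlim _ (hmem θ)).const_smul _).const_smul _
  have hd := (hasFPowerSeriesOn_cauchy_integral hci hR0).analyticAt.differentiableAt
  refine (hd.congr_of_eventuallyEq ?_).differentiableWithinAt
  filter_upwards [Metric.ball_mem_nhds c hR] with w hw
  exact (hcauchy w hw).symm

theorem HInfty.mem_of_tendsto {Ω : Set ℂ} (hΩ : IsOpen Ω) {s : ℕ → Ω → ℂ} {s₀ : Ω → ℂ}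
    (hs : ∀ n, s n ∈ HInfty Ω) {K : ℝ} (hK : ∀ n z, ‖s n z‖ ≤ K)
    (hlim : ∀ z, Tendsto (fun n => s n z) atTop (𝓝 (s₀ z))) : s₀ ∈ HInfty Ω := by
  classical
  choose G hG hGs using fun n => (hs n).1
  let G₀ : ℂ → ℂ := fun z => if h : z ∈ Ω then s₀ ⟨z, h⟩ else 0
  have hG₀ : ∀ z : Ω, G₀ z = s₀ z := fun z => by simp [G₀]
  refine ⟨⟨G₀, differentiableOn_of_bounded_tendsto hΩ hG (K := K) (fun n z hz => ?_)
    (fun z hz => ?_), hG₀⟩, K, fun z => ?_⟩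
  · rw [hGs n ⟨z, hz⟩]
    exact hK n _
  · rw [hG₀ ⟨z, hz⟩]
    simpa only [hGs _ ⟨z, hz⟩] using hlim ⟨z, hz⟩
  · exact le_of_tendsto (hlim z).norm (Eventually.of_forall fun n => hK n z)

theorem HInfty.continuous {Ω : Set ℂ} {s : Ω → ℂ} (hs : s ∈ HInfty Ω) : Continuous s := by
  obtain ⟨⟨G, hG, hGs⟩, -⟩ := hs
  have := hG.continuousOn.domRestrict
  convert this using 1
  exact funext fun z => (hGs z).symm

/-- Sums with countable support can be computed along one sequence of finite sets. -/
theorem exists_seq_finset_tendsto_sum {ι : Type*} {I : Set ι} (hI : I.Countable) :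
    ∃ s : ℕ → Finset ι, ∀ (a : ι → ℂ) (t : ℂ), Function.support a ⊆ I → HasSum a t →
      Tendsto (fun n => ∑ i ∈ s n, a i) atTop (𝓝 t) := by
  have : Countable I := hI
  obtain ⟨s, hs⟩ := exists_seq_tendsto (atTop : Filter (Finset I))
  refine ⟨fun n => (s n).map (Function.Embedding.subtype _), fun a t ha h => ?_⟩
  simp only [Finset.sum_map]
  exact ((hasSum_subtype_iff_of_support_subset ha).2 h).comp hs

/-! ### The coordinate expansion of `⟨f, g⟩` -/

section Pairing

variable {Ω : Set ℂ} {H : Type*} [NormedAddCommGroup H] [InnerProductSpace ℂ H]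

/-- Each vector `f z` has countably many nonzero coordinates, and a coordinate function, being
continuous, vanishes if it does so on a countable dense subset of `Ω`. -/
theorem countable_coordinates_ne_zero {ι : Type*} (b : HilbertBasis ι ℂ H) {f : Ω → H}
    (hf : MemValued (HInfty Ω) f) : {i | (fun z => innerSL ℂ (b i) (f z)) ≠ 0}.Countable := by
  obtain ⟨D, hDc, hD⟩ := TopologicalSpace.exists_countable_dense Ω
  have hc : ∀ z : Ω, {i | inner ℂ (b i) (f z) ≠ 0}.Countable := fun z => by
    refine (b.hasSum_repr (f z)).summable.countable_support.mono fun i hi => ?_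
    rw [Function.mem_support, b.repr_apply_apply]
    exact smul_ne_zero hi (b.orthonormal.ne_zero i)
  refine (hDc.biUnion fun z _ => hc z).mono fun i hi => ?_
  by_contra h
  refine hi ?_
  simp only [Set.mem_iUnion, not_exists] at h
  refine Continuous.ext_on hD (HInfty.continuous (hf _)) continuous_const fun z hz => ?_
  exact not_not.1 (h z hz)

theorem hasSum_coordinates {ι : Type*} (b : HilbertBasis ι ℂ H) (v : H) (φ : StrongDual ℂ H) :
    HasSum (fun i => innerSL ℂ (b i) v * φ (b i)) (φ v) := by
  simpa [b.repr_apply_apply] using (b.hasSum_repr v).mapL φ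

/-- The partial sums of the expansion of `⟨f, g⟩` in coordinates are uniformly bounded. -/
theorem exists_norm_sum_coordinates_le [CompleteSpace H] {ι : Type*} {b : ι → H}
    (hb : Orthonormal ℂ b) {f : Ω → H} (hf : MemValued (HInfty Ω) f) {g : Ω → StrongDual ℂ H}
    (hg : MemDualValued (HInfty Ω) g) :
    ∃ K : ℝ, ∀ (s : Finset ι) (z : Ω), ‖∑ i ∈ s, innerSL ℂ (b i) (f z) * g z (b i)‖ ≤ K := by
  -- Boundedness of `f` and `g` is assumed only weakly; uniform boundedness makes both bounded in
  -- norm.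
  obtain ⟨M, hM⟩ := exists_norm_le_of_weakly_bounded fun h' => (hf h').2
  obtain ⟨N, hN⟩ := banach_steinhaus fun h => (hg h).2
  refine ⟨N * M, fun s z => ?_⟩
  have h : ∑ i ∈ s, innerSL ℂ (b i) (f z) * g z (b i) =
      g z (∑ i ∈ s, inner ℂ (b i) (f z) • b i) := by
    simp [map_sum]
  rw [h]
  exact (g z).le_of_opNorm_le_of_le (hN z) ((norm_sum_inner_smul_le hb s _).trans (hM z))

theorem pairing_mem_HInfty [CompleteSpace H] (hΩ : IsOpen Ω) {f : Ω → H}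
    (hf : MemValued (HInfty Ω) f) {g : Ω → StrongDual ℂ H} (hg : MemDualValued (HInfty Ω) g) :
    pairing f g ∈ HInfty Ω := by
  obtain ⟨w, b, _⟩ := exists_hilbertBasis ℂ H
  obtain ⟨s, hs⟩ := exists_seq_finset_tendsto_sum (countable_coordinates_ne_zero b hf)
  obtain ⟨K, hK⟩ := exists_norm_sum_coordinates_le b.orthonormal hf hg
  refine HInfty.mem_of_tendsto hΩ
    (s := fun n => ∑ i ∈ s n, (fun z => innerSL ℂ (b i) (f z)) * fun z => g z (b i))
    (fun n => sum_mem fun i _ => mul_mem (hf _) (hg _)) (K := K) (fun n z => ?_) fun z => ?_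
  · simpa only [Finset.sum_apply, Pi.mul_apply] using hK (s n) z
  · simp only [Finset.sum_apply, Pi.mul_apply]
    refine hs _ _ (fun i hi h0 => hi ?_) (hasSum_coordinates b (f z) (g z))
    change innerSL ℂ (b i) (f z) * _ = 0
    rw [show innerSL ℂ (b i) (f z) = 0 from congrFun h0 z, zero_mul]

end Pairing

/-! ### Identification of the adjoint with `Φ(⟨f, g⟩)` -/

section Main

variable {Ω : Set ℂ} {X : Type*} [NormedAddCommGroup X] [NormedSpace ℂ X]
  {C : FunctionalCalculus (HInfty Ω) X}

theorem IsUniversalRegulariser.isRegulariser {e : C.E} (he : IsUniversalRegulariser C e)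
    {f : Ω → ℂ} (hf : f ∈ HInfty Ω) : C.IsRegulariser e f :=
  ⟨he.mul_mem f hf, he.injective⟩

variable {H : Type*} [NormedAddCommGroup H] [InnerProductSpace ℂ H] [CompleteSpace H]
  {f : Ω → H} {g : Ω → StrongDual ℂ H}

theorem enorm_le_of_mem_traceAdjointGraph {K : ℝ≥0} (hK : C.PhiGammaDualBound f K)
    {U : gammaRad H X} {y : X} (hy : (U, y) ∈ traceAdjointGraph (C.PhiGammaDual f)) :
    ‖y‖ₑ ≤ K * gammaNorm U.1 := by
  have hU : gammaNorm U.1 < ∞ := U.2.1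
  obtain ⟨c, hc⟩ : ∃ c : ℝ≥0, gammaNorm U.1 = c := ⟨_, (ENNReal.coe_toNNReal hU.ne).symm⟩
  rw [hc, ← ENNReal.coe_mul, enorm_eq_nnnorm, ENNReal.coe_le_coe, ← NNReal.coe_le_coe]
  refine NormedSpace.norm_le_dual_bound ℂ _ (NNReal.coe_nonneg _) fun x' => ?_
  have hx' : x' ∈ (C.PhiGammaDual f).domain := hK.1 ▸ Submodule.mem_top
  have h := ((hy ⟨x', hx'⟩).enorm_le).trans (mul_le_mul_left (hK.2 ⟨x', hx'⟩) _)
  change ‖x' y‖ₑ ≤ _ * gammaNorm U.1 at h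
  rw [hc, enorm_eq_nnnorm, enorm_eq_nnnorm, ← ENNReal.coe_mul, ← ENNReal.coe_mul,
    ENNReal.coe_le_coe, ← NNReal.coe_le_coe] at h
  push_cast at h ⊢
  rw [mul_right_comm]
  exact h

variable [CompleteSpace X]

/-- The point representing `x' ↦ ⟨Φ_γ(g) x, Φ_γ'(f) x'⟩` is `Φ(⟨f, g⟩) x`. -/
theorem mem_graph_Phi_pairing {e : C.E} (he : IsUniversalRegulariser C e) (hΩ : IsOpen Ω)
    (hf : MemValued (HInfty Ω) f) (hg : MemDualValued (HInfty Ω) g) (hfd : C.DualWellDefined f)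
    (htop : (C.PhiGammaDual f).domain = ⊤) {x y : X} {U : gammaRad H X}
    (hU : (x, U) ∈ (C.PhiGamma g).graph)
    (hy : (U, y) ∈ traceAdjointGraph (C.PhiGammaDual f)) :
    (x, y) ∈ (C.Phi (pairing f g)).graph := by
  have hfg := pairing_mem_HInfty hΩ hf hg
  rw [C.mem_graph_Phi_iff (he.isRegulariser hfg)]
  refine (SeparatingDual.eq_iff_forall_dual_eq (R := ℂ)).2 fun x' => ?_
  obtain ⟨w, b, _⟩ := exists_hilbertBasis ℂ H
  obtain ⟨s, hs⟩ := exists_seq_finset_tendsto_sum (countable_coordinates_ne_zero b hf)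
  obtain ⟨K, hK⟩ := exists_norm_sum_coordinates_le b.orthonormal hf hg
  let p : w → Ω → ℂ := fun i => (fun z => innerSL ℂ (b i) (f z)) * fun z => g z (b i)
  have hp : ∀ i, p i ∈ HInfty Ω := fun i => mul_mem (hf _) (hg _)
  have hsup : ∀ i, (fun z => innerSL ℂ (b i) (f z)) = 0 → p i = 0 := fun i h0 => by
    simp only [p, h0, zero_mul]
  have hps : ∀ n, ∑ i ∈ s n, p i ∈ HInfty Ω := fun n => sum_mem fun i _ => hp i
  -- Composing with `Φ(e)` regularises the products `Φ(⟨f, h'⟩) Φ(⟨h, g⟩)`, so that every term of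
  -- the trace lies in the elementary calculus.
  let y' : (C.PhiGammaDual f).domain := ⟨x'.comp (C.Φ e), htop ▸ Submodule.mem_top⟩
  have hV := C.mem_graph_PhiGammaDual.1 ((C.PhiGammaDual f).mem_graph y')
  have hterm : ∀ i, (C.PhiGammaDual f y').1 (innerSL ℂ (b i)) (U.1 (b i)) =
      x' (C.Φ ⟨(e : Ω → ℂ) * p i, he.mul_mem _ (hp i)⟩ x) := fun i => by
    have hef := he.isRegulariser (hf (innerSL ℂ (b i)))
    have hdom := FunctionalCalculus.domain_Phi_eq_top hfd htop _ hef
    let v : (C.Phi fun z => innerSL ℂ (b i) (f z)).domain := ⟨U.1 (b i), hdom ▸ Submodule.mem_top⟩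
    have h1 := (mem_graph_adjointOp (hfd _)).1 (hV (innerSL ℂ (b i))) v
    have h2 := C.mem_graph_Phi_mul hef (he.isRegulariser (hg (b i))) (he.isRegulariser (hp i))
      (C.mem_graph_PhiGamma.1 hU (b i)) ((C.Phi _).mem_graph v)
    rw [C.mem_graph_Phi_iff (he.isRegulariser (hp i))] at h2
    rw [← h2]
    exact h1.symm
  have hsum : HasSum (fun i => x' (C.Φ ⟨(e : Ω → ℂ) * p i, he.mul_mem _ (hp i)⟩ x))
      (x' (C.Φ e y)) := by
    have h := hy y' w b
    simp only [hterm] at h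
    exact h
  -- The sequence `s` serves both series: it sums the trace to `x' (C.Φ e y)` and the `p i`
  -- pointwise to `pairing f g`.
  refine tendsto_nhds_unique (hs _ _ (fun i hi h0 => hi ?_) hsum) ?_
  · have : (⟨(e : Ω → ℂ) * p i, he.mul_mem _ (hp i)⟩ : C.E) = 0 :=
      Subtype.ext (by simp [hsup i h0])
    change x' (C.Φ ⟨(e : Ω → ℂ) * p i, he.mul_mem _ (hp i)⟩ x) = 0
    rw [this, map_zero, zero_apply, map_zero]
  · have hconv := he.weak_conv (fun n => ∑ i ∈ s n, p i) (pairing f g) hps hfg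
      ⟨K, fun n z => by simpa only [p, Finset.sum_apply, Pi.mul_apply] using hK (s n) z⟩
      (fun z => by
        simp only [p, Finset.sum_apply, Pi.mul_apply]
        refine hs _ _ (fun i hi h0 => hi ?_) (hasSum_coordinates b (f z) (g z))
        exact congrFun (hsup i h0) z) x x'
    refine hconv.congr fun n => ?_
    have : (⟨(e : Ω → ℂ) * ∑ i ∈ s n, p i, he.mul_mem _ (hps n)⟩ : C.E) =
        ∑ i ∈ s n, ⟨(e : Ω → ℂ) * p i, he.mul_mem _ (hp i)⟩ :=
      Subtype.ext (by
        change _ = NonUnitalSubalgebraClass.subtype C.E _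
        rw [map_sum]
        exact Finset.mul_sum _ _ _)
    rw [this, map_sum, sum_apply, map_sum]

/-- If `Φ_γ'(f)` is bounded, its adjoint maps `γ(H;X)` into `X`. -/
theorem exists_mem_traceAdjointGraph {e : C.E} (he : IsUniversalRegulariser C e)
    (hf : MemValued (HInfty Ω) f) (hfd : C.DualWellDefined f) {K : ℝ≥0}
    (hK : C.PhiGammaDualBound f K) (U : gammaRad H X) :
    ∃ y, (U, y) ∈ traceAdjointGraph (C.PhiGammaDual f) := by
  have hmem : ∀ x', x' ∈ (C.PhiGammaDual f).domain := fun x' => hK.1 ▸ Submodule.mem_top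
  obtain ⟨y, hy⟩ := exists_represents_trace (fun x' => C.PhiGammaDual f ⟨x', hmem x'⟩) K
    (fun x' => hK.2 ⟨x', hmem x'⟩) (fun h' x => by
      have hef := he.isRegulariser (hf h')
      have hdom := FunctionalCalculus.domain_Phi_eq_top hfd hK.1 h' hef
      refine ⟨C.Phi (fun z => h' (f z)) ⟨x, hdom ▸ Submodule.mem_top⟩, fun x' => ?_⟩
      exact (mem_graph_adjointOp (hfd h')).1 (C.mem_graph_PhiGammaDual.1
        ((C.PhiGammaDual f).mem_graph ⟨x', hmem x'⟩) h') _) U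
  exact ⟨y, fun x' => hy x'.1⟩

end Main

end SquareFn

/-! ### The theorem and its corollary -/

theorem mainTheorem4 {Ω : Set ℂ} (hΩ : IsOpen Ω)
    {X : Type*} [NormedAddCommGroup X] [NormedSpace ℂ X] [CompleteSpace X]
    {H : Type*} [NormedAddCommGroup H] [InnerProductSpace ℂ H] [CompleteSpace H]
    (C : SquareFn.FunctionalCalculus (SquareFn.HInfty Ω) X)
    (hC : ∃ e : C.E, SquareFn.IsUniversalRegulariser C e)
    (f : Ω → H) (hf : SquareFn.MemValued (SquareFn.HInfty Ω) f)
    (g : Ω → StrongDual ℂ H) (hg : SquareFn.MemDualValued (SquareFn.HInfty Ω) g)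
    (hfd : C.DualWellDefined f)
    (hfb : ∃ K : NNReal, C.PhiGammaDualBound f K) :
    -- the inclusion of operators `Φ_γ'(f)' Φ_γ(g) ⊆ Φ(⟨f, g⟩)`
    (∀ (x y : X) (U : SquareFn.gammaRad H X), (x, U) ∈ (C.PhiGamma g).graph →
      (U, y) ∈ SquareFn.traceAdjointGraph (C.PhiGammaDual f) →
      (x, y) ∈ (C.Phi (SquareFn.pairing f g)).graph) ∧
    -- the inclusion of the domains, the duality formula and the lower estimate
    (∃ hdom : (C.PhiGamma g).domain ≤ (C.Phi (SquareFn.pairing f g)).domain,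
      (∀ (x : (C.PhiGamma g).domain) (x' : (C.PhiGammaDual f).domain),
        SquareFn.HasTraceDuality (C.PhiGamma g x) (C.PhiGammaDual f x')
          (x'.1 (C.Phi (SquareFn.pairing f g) ⟨x.1, hdom x.2⟩))) ∧
      (∀ K : NNReal, C.PhiGammaDualBound f K → ∀ x : (C.PhiGamma g).domain,
        ‖C.Phi (SquareFn.pairing f g) ⟨x.1, hdom x.2⟩‖ₑ
          ≤ K * SquareFn.gammaNorm (C.PhiGamma g x).1)) ∧
    -- the case that `Φ_γ(g)` is bounded, too
    ((∃ K : NNReal, C.PhiGammaBound g K) →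
      ((C.Phi (SquareFn.pairing f g)).domain = ⊤ ∧
        ∃ K : NNReal, ∀ x : (C.Phi (SquareFn.pairing f g)).domain,
          ‖C.Phi (SquareFn.pairing f g) x‖ ≤ K * ‖(x : X)‖) ∧
      (∀ (x : X) (hx : x ∈ (C.Phi (SquareFn.pairing f g)).domain)
        (hx' : x ∈ (C.PhiGamma g).domain) (x' : (C.PhiGammaDual f).domain),
        SquareFn.HasTraceDuality (C.PhiGamma g ⟨x, hx'⟩) (C.PhiGammaDual f x')
          (x'.1 (C.Phi (SquareFn.pairing f g) ⟨x, hx⟩))) ∧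
      (SquareFn.pairing f g = 1 → ∃ c K : NNReal, 0 < c ∧
        ∀ x : (C.PhiGamma g).domain,
          c * ‖(x : X)‖ₑ ≤ SquareFn.gammaNorm (C.PhiGamma g x).1 ∧
          SquareFn.gammaNorm (C.PhiGamma g x).1 ≤ K * ‖(x : X)‖ₑ)) := by
  obtain ⟨e, he⟩ := hC
  obtain ⟨K₀, hK₀⟩ := hfb
  have key : ∀ x : (C.PhiGamma g).domain, ∃ y,
      (x.1, y) ∈ (C.Phi (SquareFn.pairing f g)).graph ∧
      (C.PhiGamma g x, y) ∈ SquareFn.traceAdjointGraph (C.PhiGammaDual f) := fun x => by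
    obtain ⟨y, hy⟩ := SquareFn.exists_mem_traceAdjointGraph he hf hfd hK₀ (C.PhiGamma g x)
    exact ⟨y, SquareFn.mem_graph_Phi_pairing he hΩ hf hg hfd hK₀.1 (LinearPMap.mem_graph _ x) hy, hy⟩
  have hdom : (C.PhiGamma g).domain ≤ (C.Phi (SquareFn.pairing f g)).domain := fun x hx => by
    obtain ⟨y, hy, -⟩ := key ⟨x, hx⟩
    exact LinearPMap.mem_domain_of_mem_graph hy
  have hadj : ∀ x : (C.PhiGamma g).domain,
      (C.PhiGamma g x, C.Phi (SquareFn.pairing f g) ⟨x.1, hdom x.2⟩) ∈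
        SquareFn.traceAdjointGraph (C.PhiGammaDual f) := fun x => by
    obtain ⟨y, hy, hy'⟩ := key x
    rwa [← LinearPMap.mem_graph_snd_inj _ hy (LinearPMap.mem_graph _ ⟨x.1, hdom x.2⟩) rfl]
  have hest : ∀ K : NNReal, C.PhiGammaDualBound f K → ∀ x : (C.PhiGamma g).domain,
      ‖C.Phi (SquareFn.pairing f g) ⟨x.1, hdom x.2⟩‖ₑ ≤ K * SquareFn.gammaNorm (C.PhiGamma g x).1 :=
    fun K hK x => SquareFn.enorm_le_of_mem_traceAdjointGraph hK (hadj x)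
  refine ⟨fun x y U hU hy => SquareFn.mem_graph_Phi_pairing he hΩ hf hg hfd hK₀.1 hU hy,
    ⟨hdom, fun x x' => hadj x x', hest⟩, ?_⟩
  rintro ⟨L, hLtop, hL⟩
  -- The `1` in the lower constant `(K₀ + 1)⁻¹` covers `K₀ = 0`.
  refine ⟨⟨top_le_iff.1 (hLtop ▸ hdom), K₀ * L, fun x => ?_⟩,
    fun x _ hx' x' => hadj ⟨x, hx'⟩ x', fun h1 => ⟨(K₀ + 1)⁻¹, L, by positivity, fun x => ⟨?_, hL x⟩⟩⟩
  · have hx : x.1 ∈ (C.PhiGamma g).domain := hLtop ▸ Submodule.mem_top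
    have h := (hest K₀ hK₀ ⟨x.1, hx⟩).trans (mul_le_mul_right (hL ⟨x.1, hx⟩) _)
    rw [← mul_assoc, ← ENNReal.coe_mul, enorm_eq_nnnorm, enorm_eq_nnnorm, ← ENNReal.coe_mul,
      ENNReal.coe_le_coe] at h
    exact_mod_cast h
  -- For `⟨f, g⟩ = 1` the calculus gives `Φ(⟨f, g⟩) x = x`, and the estimate `hest` becomes the
  -- lower bound.
  · have hone : (x.1, x.1) ∈ (C.Phi (SquareFn.pairing f g)).graph := by
      rw [C.mem_graph_Phi_iff (he.isRegulariser (SquareFn.pairing_mem_HInfty hΩ hf hg))]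
      have : (⟨(e : Ω → ℂ) * SquareFn.pairing f g,
          he.mul_mem _ (SquareFn.pairing_mem_HInfty hΩ hf hg)⟩ : C.E) = e :=
        Subtype.ext (by simp [h1])
      rw [this]
    have h := hest K₀ hK₀ x
    rw [← LinearPMap.mem_graph_snd_inj _ hone (LinearPMap.mem_graph _ ⟨x.1, hdom x.2⟩) rfl] at h
    have h2 : ‖(x : X)‖ₑ ≤ ((K₀ + 1 : NNReal) : ENNReal) * SquareFn.gammaNorm (C.PhiGamma g x).1 :=
      h.trans (by gcongr; exact le_self_add)
    rw [ENNReal.coe_inv (by positivity), mul_comm, ← div_eq_mul_inv]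
    exact ENNReal.div_le_of_le_mul' h2
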